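/- Let $X$ be a sample space with a reference measure, let $\mathcal G$ be a set of probability measures on $X$ (the generators) having positive densities $\rho_\nu$, $\nu\in\mathcal G$, and let $\mathcal F$ be a set of functions $X\to\mathbb R$ (the discriminators). Put $$d_{\mathcal F}(\mu,\nu)=\sup_{f\in\mathcal F}\bigl(\mathbb E_{x\sim\mu}f(x)-\mathbb E_{x\sim\nu}f(x)\bigr),$$ $$\|h\|_{\mathcal F,1}=\inf\Bigl\{\sum_{i=1}^N|w_i| \;:\; h=w_0+\sum_{i=1}^N w_if_i,\ N\in\mathbb N,\ w_i\in\mathbb R,\ f_i\in\mathcal F\Bigr\},\qquad \Gamma(\mathcal F,\mathcal G)=\sup_{\nu_1,\nu_2\in\mathcal G}\bigl\|\log(\rho_{\nu_1}/\rho_{\nu_2})\bigr\|_{\mathcal F,1}.$$ Assume: (A1) for all $\nu_1,\nu_2\in\mathcal G$, $\log(\rho_{\nu_1}/\rho_{\nu_2})$ is of the form $w_0+\sum_{i=1}^N w_if_i$ with $N\in\mathbb N$, $w_i\in\mathbb R$, $f_i\in\mathcal F$ (identities between densities are understood almost everywhere); (A2) $-f\in\mathcal F$ and $\sup_{x\in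 X}|f(x)|\le\Delta$ for every $f\in\mathcal F$; (A3) $\mathcal F=\{f_\theta:\theta\in\Theta\}$ with $\Theta\subseteq[-1,1]^p$, and $\sup_{x\in X}|f_\theta(x)-f_{\theta'}(x)|\le L\|\theta-\theta'\|_2$ for all $\theta,\theta'\in\Theta$. Let $m,k\ge1$ and $n\ge 0$ be integers. Consider the following mechanism on datasets $D\in X^m$: draw $k$ i.i.d. (uniform) samples from the entries of $D$; run a (possibly randomized) training procedure on them, which returns a generator $g\in\mathcal G$; output $n$ i.i.d. samples from $g$. Assume that the training procedure has optimization error at most $\tau_{\mathrm{opt}}$: for every training set in $X^k$, with empirical distribution $\hat\mu_k$, almost surely $d_{\mathcal F}(\hat\mu_k,g)-\inf_{\nu\in\mathcal G}d_{\mathcal F}(\hat\mu_k,\nu)\le\tau_{\mathrm{opt}}$. For $\xi>0$ let $$C_\xi=16\sqrt{2\pi}\,pL+2\Delta\sqrt{2\log(1/\xi)},\qquad \varepsilon_{\mathcal F}(k,\xi)=\sup_{D\in X^m}\,2\Bigl(\inf_{\nu\in\mathcal G}d_{\mathcal F}(\hat\mu_D,\nu)+\tau_{\mathrm{opt}}+\frac{C_\xi}{\sqrt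 k}\Bigr),$$ where $\hat\mu_D$ is the empirical distribution of $D$ (the distribution that the $k$ training samples are drawn from), and where the square root of a negative number, which occurs only for $\xi>1$, is read as $0$. Then for every $\varepsilon>0$, every $\xi>0$ and every $$\delta>\frac{n\,\Gamma(\mathcal F,\mathcal G)}{\varepsilon(1-e^{-\varepsilon})}\Bigl(\frac{2\Delta}{m}+\varepsilon_{\mathcal F}(k,\xi)\Bigr)+2\xi$$ the mechanism is $(\varepsilon,\delta)$-differentially private: for all $D_0,D_1\in X^m$ that differ in at most one entry and every measurable $S\subseteq X^n$, the output $M(D)$ satisfies $\mathbb P[M(D_0)\in S]\le e^{\varepsilon}\,\mathbb P[M(D_1)\in S]+\delta$. -/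

import Mathlib

open MeasureTheory ProbabilityTheory
open scoped ENNReal

noncomputable section

namespace GANPrivacy

variable {X A : Type*} [MeasurableSpace X] [MeasurableSpace A]

/-- The integral probability metric
`d_F(μ, ν) = sup_{f ∈ F} (E_{x ∼ μ} f(x) - E_{x ∼ ν} f(x))`. -/
def ipm (F : Set (X → ℝ)) (μ ν : Measure X) : ℝ :=
  ⨆ f : F, ((∫ x, f.1 x ∂μ) - ∫ x, f.1 x ∂ν)

/-- `h = w₀ + ∑ i, w i * f i` with all `f i ∈ F`. Since `h` will be built from densities with
respect to `ref`, which are functions up to `ref`-null sets, the equality is `ref`-a.e. -/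
def Represents (F : Set (X → ℝ)) (ref : Measure X) (h : X → ℝ) {N : ℕ}
    (w₀ : ℝ) (w : Fin N → ℝ) (f : Fin N → X → ℝ) : Prop :=
  (∀ i, f i ∈ F) ∧ h =ᵐ[ref] fun x => w₀ + ∑ i, w i * f i x

/-- `h` belongs to `span F`, the set of all `w₀ + ∑ i, w i * f i` with `f i ∈ F`. -/
def InSpan (F : Set (X → ℝ)) (ref : Measure X) (h : X → ℝ) : Prop :=
  ∃ (N : ℕ) (w₀ : ℝ) (w : Fin N → ℝ) (f : Fin N → X → ℝ), Represents F ref h w₀ w f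

/-- The `F`-variation norm of `h`: the infimum of `∑ i, |w i|` over all representations
`h = w₀ + ∑ i, w i * f i` with `f i ∈ F` (and `∞` if there is none). -/
def variationNorm (F : Set (X → ℝ)) (ref : Measure X) (h : X → ℝ) : ℝ≥0∞ :=
  ⨅ (N : ℕ) (w₀ : ℝ) (w : Fin N → ℝ) (f : Fin N → X → ℝ) (_ : Represents F ref h w₀ w f),
    ∑ i, ENNReal.ofReal |w i|

/-- The density of `ν` with respect to the reference measure `ref`. -/
def density (ref ν : Measure X) (x : X) : ℝ := (ν.rnDeriv ref x).toReal

/-- The log-ratio `log (ρ_{ν₁} / ρ_{ν₂})` of the densities of `ν₁` and `ν₂`. -/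
def logDensityRatio (ref ν₁ ν₂ : Measure X) (x : X) : ℝ :=
  Real.log (density ref ν₁ x / density ref ν₂ x)

/-- `Γ(F, G) = sup_{ν₁, ν₂ ∈ G} ‖log (ρ_{ν₁} / ρ_{ν₂})‖_{F,1}`, where `G` is the family of the
distributions `gen a`. -/
def complexity (F : Set (X → ℝ)) (ref : Measure X) (gen : A → Measure X) : ℝ≥0∞ :=
  ⨆ (a : A) (b : A), variationNorm F ref (logDensityRatio ref (gen a) (gen b))

/-- The empirical distribution of the dataset `D`. -/
def empirical {m : ℕ} (D : Fin m → X) : Measure X :=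
  (m : ℝ≥0∞)⁻¹ • ∑ i, Measure.dirac (D i)

/-- `C_ξ = 16 √(2π) p L + 2 Δ √(2 log (1/ξ))`. -/
def genConst (p : ℕ) (L Δ ξ : ℝ) : ℝ :=
  16 * √(2 * Real.pi) * p * L + 2 * Δ * √(2 * Real.log (1 / ξ))

/-- `ε_F(k, ξ, μ) = 2 (inf_{ν ∈ G} d_F(μ, ν) + τ + C_ξ / √k)`, where `μ` is the distribution that
the `k` training samples are drawn from. -/
def errBound (F : Set (X → ℝ)) (gen : A → Measure X) (p : ℕ) (L Δ τ : ℝ) (k : ℕ) (ξ : ℝ)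
    (μ : Measure X) : ℝ :=
  2 * ((⨅ a, ipm F μ (gen a)) + τ + genConst p L Δ ξ / √k)

/-- `ε_F(k, ξ)` for training on `k` i.i.d. samples from an `m`-point dataset: the largest value of
`ε_F(k, ξ, μ)` over the empirical distributions `μ` of the `m`-point datasets. -/
def datasetErrBound (F : Set (X → ℝ)) (gen : A → Measure X) (p : ℕ) (L Δ τ : ℝ) (m k : ℕ) (ξ : ℝ) :
    ℝ :=
  ⨆ D : Fin m → X, errBound F gen p L Δ τ k ξ (empirical D)

/-- `n` i.i.d. samples from the generator with parameter `a`, as a kernel in `a`. -/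
def iidSamples (gen : Kernel A X) [IsMarkovKernel gen] (n : ℕ) : Kernel A (Fin n → X) where
  toFun a := Measure.pi fun _ => gen a
  measurable' := by
    refine Measurable.measure_of_isPiSystem_of_isProbabilityMeasure generateFrom_pi.symm
      isPiSystem_pi ?_
    rintro _ ⟨s, hs, rfl⟩
    simp only [Measure.pi_pi]
    exact Finset.measurable_prod _ fun i _ => gen.measurable_coe (hs i (Set.mem_univ i))

/-- The output distribution, on the dataset `D`, of the mechanism that
* draws `k` i.i.d. samples from `D`, that is, the entries of `D` at `k` i.i.d. uniform indices,
* runs the (possibly randomized) training procedure `train` on them, which returns the parameter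
  of a generator,
* and releases `n` i.i.d. samples from this generator. -/
def ganMechanism (gen : Kernel A X) [IsMarkovKernel gen] {k : ℕ}
    (train : (Fin k → X) → ProbabilityMeasure A) (m n : ℕ) (D : Fin m → X) :
    Measure (Fin n → X) :=
  (Measure.pi fun _ : Fin k => uniformOn (Set.univ : Set (Fin m))).bind fun idx =>
    (train fun j => D (idx j) : Measure A).bind (iidSamples gen n)

/-- Two datasets are neighboring if they differ in at most one element. -/
def Neighboring {m : ℕ} (D₀ D₁ : Fin m → X) : Prop :=
  ∃ i, ∀ j, j ≠ i → D₀ j = D₁ j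

/-- `(ε, δ)`-differential privacy of a mechanism on `m`-point datasets, where `M D` is the law of
the output on the dataset `D`. -/
def IsDifferentiallyPrivate {Y : Type*} [MeasurableSpace Y] {m : ℕ}
    (M : (Fin m → X) → Measure Y) (ε δ : ℝ) : Prop :=
  ∀ D₀ D₁ : Fin m → X, Neighboring D₀ D₁ → ∀ S : Set Y, MeasurableSet S →
    M D₀ S ≤ ENNReal.ofReal (Real.exp ε) * M D₁ S + ENNReal.ofReal δ

end GANPrivacy

end

/-!
For generators `P`, `Q` with log-density ratio `T = log (dP / dQ)`, the symmetrized Kullback-Leibler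
divergence `∫ T dP - ∫ T dQ` is at most `‖T‖_{F,1} d_F(P, Q)`, since `T` is a constant plus a
combination of discriminators, and `n` samples multiply it by `n`. As `∫ T (exp T - 1) dQ` has a
nonnegative integrand, the divergence bounds `ε (1 - exp (-ε))` times the probability under `P` that
`T > ε`; outside this event the privacy inequality holds with factor `exp ε`
(`measure_le_of_eq_withDensity_exp`, `pi_le_add_variationNorm`).

It remains to see that neighboring datasets lead to generators that are close in `d_F`. A resampling
of `D` is typical if its distance to `empirical D` is at most `C_ξ / (2 √k)`. After a typical
resampling, the trained generator is near-optimal for `empirical D` itself (`ipm_gen_le_of_opt`), and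
the triangle inequality through the two empirical distributions, which are `2 Δ / m` apart, bounds
the distance of the two generators. Atypical resamplings have probability at most `ξ` for each
dataset (`measure_ipm_empirical_gt_le`) and enter additively (`ganMechanism_le`).

The typical distance is bounded by McDiarmid's inequality around its mean, and the mean by chaining
along dyadic nets of the parameter cube (`integral_le_of_subgaussian_increments`). The resampling
space is finite, so that no measurability or integrability question arises there.
-/

namespace GANPrivacy

/-! ### Bounded differences inequality -/

open scoped NNReal in
/-- Hoeffding's lemma in terms of the oscillation `c` of the random variable. -/
lemma integral_exp_le_of_oscillation_le {E : Type*} [MeasurableSpace E] [Finite E]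
    [MeasurableSingletonClass E] (ν : Measure E) [IsProbabilityMeasure ν] {c : ℝ} {h : E → ℝ}
    (hh : ∀ x y, h x - h y ≤ c) (t : ℝ) :
    ∫ x, Real.exp (t * h x) ∂ν ≤ Real.exp (t * ∫ x, h x ∂ν + (c / 2) ^ 2 * t ^ 2 / 2) := by
  have : Nonempty E := nonempty_of_isProbabilityMeasure ν
  obtain ⟨y, hy⟩ := Finite.exists_min h
  have hmgf := (hasSubgaussianMGF_of_mem_Icc (μ := ν) (X := h) (a := h y) (b := h y + c)
    (Measurable.of_discrete).aemeasurable
    (ae_of_all _ fun x => ⟨hy x, by linarith [hh x y]⟩)).mgf_le t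
  have hc : ((‖h y + c - h y‖₊ / 2 : ℝ≥0) : ℝ) ^ 2 = (c / 2) ^ 2 := by
    simp [div_pow, sq_abs]
  simp only [mgf, NNReal.coe_pow, hc] at hmgf
  have hsplit : ∫ x, Real.exp (t * h x) ∂ν =
      Real.exp (t * ∫ x, h x ∂ν) * ∫ x, Real.exp (t * (h x - ∫ z, h z ∂ν)) ∂ν := by
    rw [← integral_const_mul]
    congr 1 with x
    rw [← Real.exp_add]
    ring_nf
  rw [hsplit, Real.exp_add]
  exact mul_le_mul_of_nonneg_left hmgf (Real.exp_nonneg _)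

lemma integral_pi_succ {E : Type*} [MeasurableSpace E] [Finite E] [MeasurableSingletonClass E]
    (ν : Measure E) [IsProbabilityMeasure ν] {k : ℕ} (g : (Fin (k + 1) → E) → ℝ) :
    ∫ ω, g ω ∂(Measure.pi fun _ => ν) =
      ∫ x, ∫ ω, g (Fin.cons x ω) ∂(Measure.pi fun _ : Fin k => ν) ∂ν := by
  rw [← (measurePreserving_piFinSuccAbove (fun _ : Fin (k + 1) => ν) 0).symm.integral_comp',
    integral_prod _ .of_finite]
  simp [MeasurableEquiv.piFinSuccAbove_symm_apply, Fin.insertNthEquiv]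

/-- The exponential form of McDiarmid's inequality. The coordinates are integrated out one at a
time, each by Hoeffding's lemma. -/
lemma integral_exp_le_of_bounded_differences {E : Type*} [MeasurableSpace E] [Finite E]
    [MeasurableSingletonClass E] (ν : Measure E) [IsProbabilityMeasure ν] {c : ℝ} (t : ℝ) {k : ℕ}
    (g : (Fin k → E) → ℝ) (hg : ∀ ω i x, |g (Function.update ω i x) - g ω| ≤ c) :
    ∫ ω, Real.exp (t * g ω) ∂(Measure.pi fun _ => ν) ≤
      Real.exp (t * ∫ ω, g ω ∂(Measure.pi fun _ => ν) + k * (c / 2) ^ 2 * t ^ 2 / 2) := by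
  induction k with
  | zero =>
    have h1 : ∀ f : (Fin 0 → E) → ℝ, ∫ ω, f ω ∂(Measure.pi fun _ => ν) = f default := by
      intro f
      rw [integral_unique]
      simp
    rw [h1, h1]
    simp
  | succ k ih =>
    rw [integral_pi_succ, integral_pi_succ]
    set h : E → ℝ := fun x => ∫ ω, g (Fin.cons x ω) ∂(Measure.pi fun _ : Fin k => ν) with hh
    have hosc : ∀ x y, h x - h y ≤ c := by
      intro x y
      rw [hh]
      dsimp only
      rw [← integral_sub .of_finite .of_finite]
      have : ∫ ω, (g (Fin.cons x ω) - g (Fin.cons y ω)) ∂(Measure.pi fun _ : Fin k => ν) ≤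
          ∫ _, c ∂(Measure.pi fun _ : Fin k => ν) := by
        refine integral_mono .of_finite .of_finite fun ω => ?_
        have := hg (Fin.cons y ω) 0 x
        rw [Fin.update_cons_zero] at this
        exact (abs_le.1 this).2
      simpa using this
    calc ∫ x, ∫ ω, Real.exp (t * g (Fin.cons x ω)) ∂(Measure.pi fun _ : Fin k => ν) ∂ν
        ≤ ∫ x, Real.exp (k * (c / 2) ^ 2 * t ^ 2 / 2) * Real.exp (t * h x) ∂ν := by
          refine integral_mono .of_finite .of_finite fun x => ?_
          dsimp only
          rw [← Real.exp_add, add_comm (_ / 2) (t * h x)]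
          refine ih (fun ω => g (Fin.cons x ω)) fun ω i z => ?_
          rw [Fin.cons_update]
          exact hg _ _ _
      _ ≤ Real.exp (k * (c / 2) ^ 2 * t ^ 2 / 2) *
          Real.exp (t * ∫ x, h x ∂ν + (c / 2) ^ 2 * t ^ 2 / 2) := by
          rw [integral_const_mul]
          gcongr
          exact integral_exp_le_of_oscillation_le ν hosc t
      _ = _ := by
          rw [← Real.exp_add]
          push_cast
          ring_nf

/-- **McDiarmid's inequality**. -/
lemma measure_le_sub_integral_le {E : Type*} [MeasurableSpace E] [Finite E]
    [MeasurableSingletonClass E] (ν : Measure E) [IsProbabilityMeasure ν] {c : ℝ} (hc : 0 < c)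
    {k : ℕ} (hk : 0 < k)
    (g : (Fin k → E) → ℝ) (hg : ∀ ω i x, |g (Function.update ω i x) - g ω| ≤ c) {s : ℝ}
    (hs : 0 ≤ s) :
    (Measure.pi fun _ => ν) {ω | s ≤ g ω - ∫ ω, g ω ∂(Measure.pi fun _ => ν)} ≤
      ENNReal.ofReal (Real.exp (-(2 * s ^ 2 / (k * c ^ 2)))) := by
  set P : Measure (Fin k → E) := Measure.pi fun _ => ν
  have hk' : (0 : ℝ) < k := by exact_mod_cast hk
  -- the minimizer of `k (c / 2) ^ 2 t ^ 2 / 2 - t s`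
  set t : ℝ := 4 * s / (k * c ^ 2) with ht
  have ht0 : 0 ≤ t := by positivity
  have h1 := measure_ge_le_exp_mul_mgf (μ := P) (X := fun ω => g ω) (s + ∫ ω, g ω ∂P) ht0
    Integrable.of_finite
  rw [← ofReal_measureReal]
  refine ENNReal.ofReal_le_ofReal ?_
  have h2 : {ω | s ≤ g ω - ∫ ω, g ω ∂P} = {ω | s + ∫ ω, g ω ∂P ≤ g ω} := by
    ext ω
    simp only [Set.mem_ofPred_eq]
    constructor <;> intro h <;> linarith
  rw [h2]
  refine h1.trans ?_
  refine (mul_le_mul_of_nonneg_left (integral_exp_le_of_bounded_differences ν t g hg)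
    (Real.exp_nonneg _)).trans ?_
  rw [← Real.exp_add, Real.exp_le_exp, ht]
  apply le_of_eq
  field_simp
  ring

/-! ### Chaining over a cube -/

lemma integral_sup'_le {Ω ι : Type*} [MeasurableSpace Ω] [Finite Ω] [MeasurableSingletonClass Ω]
    (P : Measure Ω) [IsProbabilityMeasure P] {T : Finset ι} (hT : T.Nonempty) (Y : ι → Ω → ℝ)
    {s a : ℝ} (hs : 0 < s) (ha : 0 < a) (hcard : Real.log T.card ≤ a)
    (hY : ∀ i ∈ T, ∀ t, ∫ ω, Real.exp (t * Y i ω) ∂P ≤ Real.exp (s ^ 2 * t ^ 2 / 2)) :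
    ∫ ω, T.sup' hT (fun i => Y i ω) ∂P ≤ s * √(2 * a) := by
  set M : Ω → ℝ := fun ω => T.sup' hT (fun i => Y i ω) with hM
  set t : ℝ := √(2 * a) / s with ht
  have ht0 : 0 < t := by positivity
  have hjensen : Real.exp (∫ ω, t * M ω ∂P) ≤ ∫ ω, Real.exp (t * M ω) ∂P :=
    convexOn_exp.map_integral_le (μ := P) (f := fun ω => t * M ω) Real.continuous_exp.continuousOn
      isClosed_univ (by simp) .of_finite .of_finite
  have hsum : ∫ ω, Real.exp (t * M ω) ∂P ≤ T.card * Real.exp (s ^ 2 * t ^ 2 / 2) := by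
    calc ∫ ω, Real.exp (t * M ω) ∂P ≤ ∫ ω, ∑ i ∈ T, Real.exp (t * Y i ω) ∂P := by
          refine integral_mono .of_finite .of_finite fun ω => ?_
          obtain ⟨i, hi, hiM⟩ := T.exists_mem_eq_sup' hT (fun i => Y i ω)
          simp only [hM, hiM]
          exact Finset.single_le_sum (f := fun i => Real.exp (t * Y i ω))
            (fun i _ => (Real.exp_pos _).le) hi
      _ = ∑ i ∈ T, ∫ ω, Real.exp (t * Y i ω) ∂P := integral_finsetSum _ fun _ _ => .of_finite
      _ ≤ ∑ i ∈ T, Real.exp (s ^ 2 * t ^ 2 / 2) := Finset.sum_le_sum fun i hi => hY i hi t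
      _ = _ := by simp
  have hN : (T.card : ℝ) ≤ Real.exp a := by
    rwa [← Real.log_le_iff_le_exp (by exact_mod_cast hT.card_pos)]
  have hexp : Real.exp (∫ ω, t * M ω ∂P) ≤ Real.exp (a + s ^ 2 * t ^ 2 / 2) := by
    rw [Real.exp_add]
    exact hjensen.trans (hsum.trans (mul_le_mul_of_nonneg_right hN (Real.exp_pos _).le))
  rw [Real.exp_le_exp, integral_const_mul] at hexp
  have hq : √(2 * a) ^ 2 = 2 * a := Real.sq_sqrt (by positivity)
  have hval : a + s ^ 2 * t ^ 2 / 2 = t * (s * √(2 * a)) := by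
    rw [ht]
    generalize √(2 * a) = q at hq
    field_simp
    linarith
  rw [hval] at hexp
  exact le_of_mul_le_mul_left hexp ht0

/-- Dyadic nets of a subset of the cube, with points in this subset. -/
lemma exists_dyadic_net {p : ℕ} {Θ : Set (EuclideanSpace ℝ (Fin p))} (hne : Θ.Nonempty)
    (hΘ : ∀ θ ∈ Θ, ∀ i, θ i ∈ Set.Icc (-1 : ℝ) 1) (j : ℕ) :
    ∃ T : Finset (EuclideanSpace ℝ (Fin p)), T.Nonempty ∧ (∀ θ ∈ T, θ ∈ Θ) ∧
      T.card ≤ 2 ^ (j * p) ∧ ∀ θ ∈ Θ, ∃ t ∈ T, ‖θ - t‖ ≤ 4 * √p / 2 ^ j := by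
  classical
  -- The cells have side `4 / 2 ^ j` and not `2 / 2 ^ j`, to leave room for the right end point.
  set φ : EuclideanSpace ℝ (Fin p) → Fin p → ℕ := fun θ i => ⌊2 ^ j * ((θ i + 1) / 4)⌋₊ with hφ
  set C : Finset (Fin p → ℕ) := Fintype.piFinset fun _ => Finset.range (2 ^ j) with hC
  have hmaps : φ '' Θ ⊆ C := by
    rintro _ ⟨θ, hθ, rfl⟩
    simp only [hC, Finset.mem_coe, Fintype.mem_piFinset, Finset.mem_range, hφ]
    intro i
    have h := hΘ θ hθ i
    rw [Nat.floor_lt (mul_nonneg (by positivity) (by linarith [h.1]))]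
    push_cast
    have h2 : (0 : ℝ) < 2 ^ j := by positivity
    nlinarith [h.2]
  obtain ⟨S, hSΘ, hS⟩ := (Set.surjOn_image φ Θ).exists_bijOn_subset
  have hfin : S.Finite := hS.finite_iff_finite.2 (C.finite_toSet.subset hmaps)
  refine ⟨hfin.toFinset, ?_, fun θ hθ => hSΘ (hfin.mem_toFinset.1 hθ), ?_, fun θ hθ => ?_⟩
  · obtain ⟨θ, hθ⟩ := hne
    obtain ⟨t, ht, -⟩ := hS.surjOn (Set.mem_image_of_mem φ hθ)
    exact ⟨t, hfin.mem_toFinset.2 ht⟩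
  · have : hfin.toFinset.card ≤ C.card := by
      refine Finset.card_le_card_of_injOn φ (fun t ht => ?_) fun a ha b hb h => ?_
      · exact hmaps (hS.mapsTo (hfin.mem_toFinset.1 ht))
      · exact hS.injOn (hfin.mem_toFinset.1 ha) (hfin.mem_toFinset.1 hb) h
    refine this.trans ?_
    simp [hC, pow_mul]
  · obtain ⟨t, ht, htφ⟩ := hS.surjOn (Set.mem_image_of_mem φ hθ)
    refine ⟨t, hfin.mem_toFinset.2 ht, ?_⟩
    have h2 : (0 : ℝ) < 2 ^ j := by positivity
    have hcoord : ∀ i, ‖(θ - t) i‖ ^ 2 ≤ (4 / 2 ^ j) ^ 2 := by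
      intro i
      have hfl := congrFun htφ i
      simp only [hφ] at hfl
      have ha := Nat.floor_le (a := (2 : ℝ) ^ j * ((θ i + 1) / 4))
        (mul_nonneg h2.le (by linarith [(hΘ θ hθ i).1]))
      have hb := Nat.floor_le (a := (2 : ℝ) ^ j * ((t i + 1) / 4))
        (mul_nonneg h2.le (by linarith [(hΘ t (hSΘ ht) i).1]))
      have ha' := Nat.lt_floor_add_one ((2 : ℝ) ^ j * ((θ i + 1) / 4))
      have hb' := Nat.lt_floor_add_one ((2 : ℝ) ^ j * ((t i + 1) / 4))
      rw [hfl] at hb hb'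
      have habs : |(θ - t) i| ≤ 4 / 2 ^ j := by
        rw [PiLp.sub_apply, abs_le, le_div_iff₀ h2, ← neg_div, div_le_iff₀ h2]
        constructor <;> linarith
      rw [Real.norm_eq_abs]
      gcongr
    rw [EuclideanSpace.norm_eq]
    refine (Real.sqrt_le_sqrt (Finset.sum_le_sum fun i _ => hcoord i)).trans (le_of_eq ?_)
    simp only [Finset.sum_const, Finset.card_univ, Fintype.card_fin, nsmul_eq_mul]
    rw [Real.sqrt_mul (by positivity), Real.sqrt_sq (by positivity)]
    ring

lemma sum_range_succ_div_two_pow (J : ℕ) :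
    ∑ j ∈ Finset.range J, ((j : ℝ) + 1) / 2 ^ j = 4 - (2 * J + 4) / 2 ^ J := by
  induction J with
  | zero => norm_num
  | succ J ih =>
    rw [Finset.sum_range_succ, ih]
    push_cast
    field_simp
    ring

/-- Chaining: the expected supremum of a centered process on a subset of the cube `[-1, 1] ^ p`
with sub-Gaussian increments. The process is assumed to have Lipschitz paths, with any constant `C`,
so that its supremum is approximated by maxima over finite nets. -/
lemma integral_le_of_subgaussian_increments {Ω : Type*} [MeasurableSpace Ω] [Finite Ω]
    [MeasurableSingletonClass Ω] (P : Measure Ω) [IsProbabilityMeasure P] {p : ℕ} (hp : 0 < p)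
    {Θ : Set (EuclideanSpace ℝ (Fin p))} (hne : Θ.Nonempty)
    (hΘ : ∀ θ ∈ Θ, ∀ i, θ i ∈ Set.Icc (-1 : ℝ) 1) (Z : EuclideanSpace ℝ (Fin p) → Ω → ℝ)
    {σ C : ℝ} (hσ : 0 < σ) (hC : 0 ≤ C) (hmean : ∀ θ ∈ Θ, ∫ ω, Z θ ω ∂P = 0)
    (hsub : ∀ θ ∈ Θ, ∀ θ' ∈ Θ, ∀ t, ∫ ω, Real.exp (t * (Z θ ω - Z θ' ω)) ∂P ≤
      Real.exp ((σ * ‖θ - θ'‖) ^ 2 * t ^ 2 / 2))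
    (hlip : ∀ θ ∈ Θ, ∀ θ' ∈ Θ, ∀ ω, Z θ ω - Z θ' ω ≤ C * ‖θ - θ'‖)
    (G : Ω → ℝ) (hG : ∀ ω b, (∀ θ ∈ Θ, Z θ ω ≤ b) → G ω ≤ b) :
    ∫ ω, G ω ∂P ≤ 16 * √(2 * Real.log 2) * p * σ := by
  have hp' : (0 : ℝ) < p := by exact_mod_cast hp
  have hlog : 0 < Real.log 2 := Real.log_pos one_lt_two
  choose T hTne hTΘ hTcard hTnet using exists_dyadic_net hne hΘ
  set K : ℝ := 4 * √(2 * Real.log 2) * p * σ with hK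
  have hstep : ∀ j, ∫ ω, (T (j + 1)).sup' (hTne _) (fun θ => Z θ ω) ∂P ≤
      ∫ ω, (T j).sup' (hTne _) (fun θ => Z θ ω) ∂P + K * ((j + 1) / 2 ^ j) := by
    intro j
    have hπ : ∀ θ, ∃ θ', θ ∈ T (j + 1) → θ' ∈ T j ∧ ‖θ - θ'‖ ≤ 4 * √p / 2 ^ j := by
      intro θ
      by_cases h : θ ∈ T (j + 1)
      · obtain ⟨t, ht, hd⟩ := hTnet j θ (hTΘ _ θ h)
        exact ⟨t, fun _ => ⟨ht, hd⟩⟩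
      · exact ⟨θ, fun h' => absurd h' h⟩
    choose π hπ using hπ
    have hinc := integral_sup'_le P (hTne (j + 1)) (fun θ ω => Z θ ω - Z (π θ) ω)
      (s := σ * (4 * √p / 2 ^ j)) (a := ((j + 1) * p : ℕ) * Real.log 2) (by positivity)
      (by positivity) (by
        rw [← Real.log_pow]
        refine Real.log_le_log (by exact_mod_cast (hTne _).card_pos) ?_
        exact_mod_cast hTcard (j + 1))
      (fun θ hθ t => by
        refine (hsub θ (hTΘ _ θ hθ) (π θ) (hTΘ _ _ (hπ θ hθ).1) t).trans ?_
        have := (hπ θ hθ).2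
        gcongr)
    calc ∫ ω, (T (j + 1)).sup' (hTne _) (fun θ => Z θ ω) ∂P
        ≤ ∫ ω, ((T j).sup' (hTne _) (fun θ => Z θ ω) +
            (T (j + 1)).sup' (hTne _) (fun θ => Z θ ω - Z (π θ) ω)) ∂P := by
          refine integral_mono .of_finite .of_finite fun ω => ?_
          refine Finset.sup'_le _ _ fun θ hθ => ?_
          have h1 := Finset.le_sup' (fun θ => Z θ ω) (hπ θ hθ).1
          have h2 := Finset.le_sup' (fun θ => Z θ ω - Z (π θ) ω) hθ
          dsimp only at h1 h2 ⊢
          linarith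
      _ = ∫ ω, (T j).sup' (hTne _) (fun θ => Z θ ω) ∂P +
          ∫ ω, (T (j + 1)).sup' (hTne _) (fun θ => Z θ ω - Z (π θ) ω) ∂P :=
          integral_add .of_finite .of_finite
      _ ≤ _ := by
          gcongr
          refine hinc.trans ?_
          have h1 : 2 * (((j + 1) * p : ℕ) * Real.log 2) = (j + 1) * (p * (2 * Real.log 2)) := by
            push_cast
            ring
          have h2 : √((j : ℝ) + 1) ≤ j + 1 := by
            rw [Real.sqrt_le_left (by positivity)]
            nlinarith [(Nat.cast_nonneg j : (0 : ℝ) ≤ j)]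
          have h3 : √(p : ℝ) * √p = p := Real.mul_self_sqrt hp'.le
          rw [h1, Real.sqrt_mul (by positivity), Real.sqrt_mul hp'.le, hK]
          calc σ * (4 * √p / 2 ^ j) * (√((j : ℝ) + 1) * (√p * √(2 * Real.log 2)))
              = 4 * √(2 * Real.log 2) * (√p * √p) * σ * (√((j : ℝ) + 1) / 2 ^ j) := by ring
            _ ≤ _ := by
              rw [h3]
              gcongr
  have hchain : ∀ J, ∫ ω, (T J).sup' (hTne _) (fun θ => Z θ ω) ∂P ≤
      K * ∑ j ∈ Finset.range J, ((j : ℝ) + 1) / 2 ^ j := by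
    intro J
    induction J with
    | zero =>
      -- the coarsest net is a single point, and the process is centered
      obtain ⟨θ, hθ⟩ := Finset.card_eq_one.1
        (le_antisymm ((hTcard 0).trans (by simp)) (hTne 0).card_pos)
      have hθΘ : θ ∈ Θ := hTΘ 0 θ (by simp [hθ])
      simp [hθ, hmean θ hθΘ]
    | succ J ih =>
      rw [Finset.sum_range_succ, mul_add]
      linarith [hstep J]
  have hbound : ∀ J : ℕ, ∫ ω, G ω ∂P ≤ 4 * K + C * (4 * √p) * (1 / 2) ^ J := by
    intro J
    have h1 : ∫ ω, G ω ∂P ≤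
        ∫ ω, ((T J).sup' (hTne _) (fun θ => Z θ ω) + C * (4 * √p / 2 ^ J)) ∂P := by
      refine integral_mono .of_finite .of_finite fun ω => hG ω _ fun θ hθ => ?_
      obtain ⟨t, ht, hd⟩ := hTnet J θ hθ
      have h1 := Finset.le_sup' (fun θ => Z θ ω) ht
      have h2 := hlip θ hθ t (hTΘ _ t ht) ω
      have h3 := mul_le_mul_of_nonneg_left hd hC
      linarith
    rw [integral_add .of_finite .of_finite, integral_const] at h1
    have h2 := hchain J
    rw [sum_range_succ_div_two_pow] at h2
    have hK0 : 0 ≤ K := by positivity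
    have h3 : K * (4 - (2 * J + 4) / 2 ^ J) ≤ K * 4 := by
      gcongr
      have : (0 : ℝ) ≤ (2 * J + 4) / 2 ^ J := by positivity
      linarith
    have h4 : C * (4 * √p) * (1 / 2) ^ J = C * (4 * √p / 2 ^ J) := by
      rw [one_div, inv_pow]
      ring
    rw [h4]
    simp only [probReal_univ, one_smul] at h1
    linarith
  have hlim : Filter.Tendsto (fun J : ℕ => 4 * K + C * (4 * √p) * (1 / 2 : ℝ) ^ J) Filter.atTop
      (nhds (4 * K + C * (4 * √p) * 0)) :=
    tendsto_const_nhds.add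
      ((tendsto_pow_atTop_nhds_zero_of_lt_one (by norm_num) (by norm_num)).const_mul _)
  have := ge_of_tendsto' hlim hbound
  rw [hK] at this
  linarith

/-! ### Integral probability metrics -/

section ipm

variable {X : Type*} [MeasurableSpace X] {F : Set (X → ℝ)} {Δ : ℝ}

lemma abs_integral_le_of_mem (hbdd : ∀ f ∈ F, ∀ x, |f x| ≤ Δ) (μ : Measure X)
    [IsProbabilityMeasure μ] {f : X → ℝ} (hf : f ∈ F) : |∫ x, f x ∂μ| ≤ Δ := by
  simpa using norm_integral_le_of_norm_le_const (μ := μ) (ae_of_all μ fun x => (Real.norm_eq_abs (f x)).trans_le (hbdd f hf x))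

lemma integral_sub_integral_le_ipm (hbdd : ∀ f ∈ F, ∀ x, |f x| ≤ Δ) (μ ν : Measure X)
    [IsProbabilityMeasure μ] [IsProbabilityMeasure ν] {f : X → ℝ} (hf : f ∈ F) :
    ∫ x, f x ∂μ - ∫ x, f x ∂ν ≤ ipm F μ ν := by
  refine le_ciSup (f := fun f : F => (∫ x, f.1 x ∂μ) - ∫ x, f.1 x ∂ν) ⟨2 * Δ, ?_⟩ ⟨f, hf⟩
  rintro _ ⟨g, rfl⟩
  have h1 := abs_le.1 (abs_integral_le_of_mem hbdd μ g.2)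
  have h2 := abs_le.1 (abs_integral_le_of_mem hbdd ν g.2)
  dsimp only
  linarith

lemma ipm_le {μ ν : Measure X} {b : ℝ} (hb : 0 ≤ b)
    (h : ∀ f ∈ F, ∫ x, f x ∂μ - ∫ x, f x ∂ν ≤ b) : ipm F μ ν ≤ b :=
  Real.iSup_le (fun f => h f.1 f.2) hb

lemma abs_integral_sub_integral_le_ipm (heven : ∀ f ∈ F, -f ∈ F) (hbdd : ∀ f ∈ F, ∀ x, |f x| ≤ Δ)
    (μ ν : Measure X)
    [IsProbabilityMeasure μ] [IsProbabilityMeasure ν] {f : X → ℝ} (hf : f ∈ F) :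
    |∫ x, f x ∂μ - ∫ x, f x ∂ν| ≤ ipm F μ ν := by
  have h := integral_sub_integral_le_ipm hbdd μ ν (heven f hf)
  simp only [Pi.neg_apply, integral_neg] at h
  rw [abs_le]
  exact ⟨by linarith, integral_sub_integral_le_ipm hbdd μ ν hf⟩

lemma ipm_nonneg (heven : ∀ f ∈ F, -f ∈ F) (hbdd : ∀ f ∈ F, ∀ x, |f x| ≤ Δ)
    (μ ν : Measure X) [IsProbabilityMeasure μ] [IsProbabilityMeasure ν] :
    0 ≤ ipm F μ ν := by
  rcases F.eq_empty_or_nonempty with rfl | ⟨f, hf⟩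
  · simp [ipm]
  · exact (abs_nonneg _).trans (abs_integral_sub_integral_le_ipm heven hbdd μ ν hf)

lemma ipm_comm_le (heven : ∀ f ∈ F, -f ∈ F) (hbdd : ∀ f ∈ F, ∀ x, |f x| ≤ Δ)
    (μ ν : Measure X) [IsProbabilityMeasure μ] [IsProbabilityMeasure ν] :
    ipm F μ ν ≤ ipm F ν μ :=
  ipm_le (ipm_nonneg heven hbdd ν μ) fun f hf => by
    linarith [(abs_le.1 (abs_integral_sub_integral_le_ipm heven hbdd ν μ hf)).1]

lemma ipm_triangle (heven : ∀ f ∈ F, -f ∈ F) (hbdd : ∀ f ∈ F, ∀ x, |f x| ≤ Δ)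
    (μ ν ρ : Measure X) [IsProbabilityMeasure μ] [IsProbabilityMeasure ν]
    [IsProbabilityMeasure ρ] : ipm F μ ρ ≤ ipm F μ ν + ipm F ν ρ :=
  ipm_le (add_nonneg (ipm_nonneg heven hbdd μ ν) (ipm_nonneg heven hbdd ν ρ)) fun f hf => by
    linarith [integral_sub_integral_le_ipm hbdd μ ν hf, integral_sub_integral_le_ipm hbdd ν ρ hf]

end ipm

lemma isProbabilityMeasure_empirical {X : Type*} [MeasurableSpace X] {m : ℕ} (hm : 0 < m)
    (D : Fin m → X) : IsProbabilityMeasure (empirical D) := by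
  constructor
  simp only [empirical, Measure.smul_apply, Measure.finsetSum_apply, measure_univ,
    Finset.sum_const, Finset.card_univ, Fintype.card_fin, smul_eq_mul, nsmul_eq_mul, mul_one]
  exact ENNReal.inv_mul_cancel (by exact_mod_cast hm.ne') (ENNReal.natCast_ne_top m)

lemma integral_empirical {X : Type*} [MeasurableSpace X] {m : ℕ} (D : Fin m → X) {f : X → ℝ}
    (hf : Measurable f) : ∫ x, f x ∂(empirical D) = (m : ℝ)⁻¹ * ∑ i, f (D i) := by
  rw [empirical, integral_smul_measure, integral_finsetSum_measure]
  · simp [integral_dirac' _ _ hf.stronglyMeasurable]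
  · intro i _
    exact (integrable_dirac' hf.stronglyMeasurable (by simp))

lemma ipm_empirical_le_of_neighboring {X : Type*} [MeasurableSpace X] {F : Set (X → ℝ)} {Δ : ℝ}
    (hΔ : 0 ≤ Δ) (hmeas : ∀ f ∈ F, Measurable f) (hbdd : ∀ f ∈ F, ∀ x, |f x| ≤ Δ) {m : ℕ}
    {D₀ D₁ : Fin m → X} (h : Neighboring D₀ D₁) :
    ipm F (empirical D₀) (empirical D₁) ≤ 2 * Δ / m := by
  refine ipm_le (by positivity) fun f hf => ?_
  obtain ⟨i, hi⟩ := h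
  rw [integral_empirical _ (hmeas f hf), integral_empirical _ (hmeas f hf), ← mul_sub,
    ← Finset.sum_sub_distrib, Finset.sum_eq_single i (fun j _ hj => by simp [hi j hj])
      (fun h => absurd (Finset.mem_univ i) h), inv_mul_eq_div]
  have h1 := abs_le.1 (hbdd f hf (D₀ i))
  have h2 := abs_le.1 (hbdd f hf (D₁ i))
  gcongr
  linarith

/-! ### Generalization error of resampling -/

lemma isProbabilityMeasure_uniformOn_fin {m : ℕ} (hm : 0 < m) :
    IsProbabilityMeasure (uniformOn (Set.univ : Set (Fin m))) :=
  isProbabilityMeasure_uniformOn Set.finite_univ ⟨⟨0, hm⟩, trivial⟩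

lemma integral_uniformOn_fin {m : ℕ} (h : Fin m → ℝ) :
    ∫ i, h i ∂(uniformOn (Set.univ : Set (Fin m))) = (m : ℝ)⁻¹ * ∑ i, h i := by
  rcases Nat.eq_zero_or_pos m with rfl | hm
  · simp [Subsingleton.elim _ (0 : Measure (Fin 0))]
  have := isProbabilityMeasure_uniformOn_fin hm
  rw [integral_fintype .of_finite, Finset.mul_sum]
  refine Finset.sum_congr rfl fun i _ => ?_
  simp [measureReal_def, uniformOn_univ]

/-- The expected `ipm F` distance between `empirical D` and a sample of size `k` from it. No
symmetrization is needed: by Hoeffding's lemma the increments of the centered empirical process are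
sub-Gaussian with parameter `L ‖θ - θ'‖ / √k`. -/
lemma integral_ipm_empirical_le {X : Type*} [MeasurableSpace X] {p : ℕ} (hp : 0 < p)
    {Θ : Set (EuclideanSpace ℝ (Fin p))} {disc : EuclideanSpace ℝ (Fin p) → X → ℝ}
    {F : Set (X → ℝ)} (hF : F = disc '' Θ) (hne : Θ.Nonempty) (hmeas : ∀ f ∈ F, Measurable f)
    {L : ℝ} (hL : 0 < L)
    (hΘ : ∀ θ ∈ Θ, ∀ i, θ i ∈ Set.Icc (-1 : ℝ) 1)
    (hLip : ∀ θ ∈ Θ, ∀ θ' ∈ Θ, ∀ x, |disc θ x - disc θ' x| ≤ L * ‖θ - θ'‖)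
    {m k : ℕ} (hm : 0 < m) (hk : 0 < k) (D : Fin m → X) :
    ∫ idx, ipm F (empirical fun j => D (idx j)) (empirical D)
        ∂(Measure.pi fun _ : Fin k => uniformOn (Set.univ : Set (Fin m))) ≤
      16 * √(2 * Real.log 2) * p * (L / √k) := by
  have := isProbabilityMeasure_uniformOn_fin hm
  have := isProbabilityMeasure_empirical hm D
  have hk' : (0 : ℝ) < k := by exact_mod_cast hk
  set ν := uniformOn (Set.univ : Set (Fin m)) with hν
  have hint : ∀ h : Fin m → ℝ, ∫ idx, (k : ℝ)⁻¹ * ∑ j, h (idx j) ∂(Measure.pi fun _ : Fin k => ν) =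
      (m : ℝ)⁻¹ * ∑ i, h i := by
    intro h
    rw [integral_const_mul, integral_finsetSum _ fun _ _ => .of_finite]
    simp_rw [integral_comp_eval (μ := fun _ : Fin k => ν) (f := h)
      Measurable.of_discrete.aestronglyMeasurable]
    rw [← integral_uniformOn_fin h, ← hν]
    simp only [Finset.sum_const, Finset.card_univ, Fintype.card_fin, nsmul_eq_mul]
    field_simp
  set Z : EuclideanSpace ℝ (Fin p) → (Fin k → Fin m) → ℝ := fun θ idx =>
    (k : ℝ)⁻¹ * ∑ j, disc θ (D (idx j)) - (m : ℝ)⁻¹ * ∑ i, disc θ (D i) with hZ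
  have hmean : ∀ θ, ∫ idx, Z θ idx ∂(Measure.pi fun _ : Fin k => ν) = 0 := by
    intro θ
    rw [hZ]
    dsimp only
    rw [integral_sub .of_finite .of_finite, hint fun i => disc θ (D i)]
    simp
  have hmem : ∀ θ ∈ Θ, disc θ ∈ F := fun θ hθ => hF ▸ Set.mem_image_of_mem _ hθ
  refine integral_le_of_subgaussian_increments _ hp hne hΘ Z (C := 2 * L) (by positivity)
    (by positivity) (fun θ _ => hmean θ) ?_ ?_ _ ?_
  · intro θ hθ θ' hθ' t
    refine (integral_exp_le_of_bounded_differences ν (c := 2 * (L * ‖θ - θ'‖) / k) t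
      (fun ω => Z θ ω - Z θ' ω) ?_).trans (le_of_eq ?_)
    · intro ω i x
      have hsum : ∀ h : Fin m → ℝ, (k : ℝ)⁻¹ * ∑ j, h (Function.update ω i x j) -
          (k : ℝ)⁻¹ * ∑ j, h (ω j) = (h x - h (ω i)) / k := by
        intro h
        rw [← mul_sub, ← Finset.sum_sub_distrib, Finset.sum_eq_single i
          (fun j _ hj => by simp [Function.update_of_ne hj])
          (fun h => absurd (Finset.mem_univ i) h)]
        simp [inv_mul_eq_div]
      have h1 := hsum fun i => disc θ (D i)
      have h2 := hsum fun i => disc θ' (D i)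
      have h3 : Z θ (Function.update ω i x) - Z θ' (Function.update ω i x) -
          (Z θ ω - Z θ' ω) =
          ((disc θ (D x) - disc θ' (D x)) - (disc θ (D (ω i)) - disc θ' (D (ω i)))) / k := by
        simp only [hZ]
        rw [sub_div, sub_div, sub_div]
        rw [sub_div] at h1 h2
        linarith
      rw [h3, abs_div, abs_of_pos hk']
      gcongr
      refine (abs_sub _ _).trans ?_
      linarith [hLip θ hθ θ' hθ' (D x), hLip θ hθ θ' hθ' (D (ω i))]
    · rw [integral_sub .of_finite .of_finite, hmean, hmean]
      have hsq : √(k : ℝ) ^ 2 = k := Real.sq_sqrt hk'.le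
      congr 1
      rw [mul_pow (L / √k), div_pow L, hsq]
      field_simp
      ring
  · intro θ hθ θ' hθ' ω
    have h1 : (k : ℝ)⁻¹ * ∑ j, disc θ (D (ω j)) - (k : ℝ)⁻¹ * ∑ j, disc θ' (D (ω j)) ≤
        L * ‖θ - θ'‖ := by
      rw [← mul_sub, ← Finset.sum_sub_distrib, inv_mul_le_iff₀ hk']
      refine (Finset.sum_le_sum fun j _ => (abs_le.1 (hLip θ hθ θ' hθ' (D (ω j)))).2).trans ?_
      simp
    have h2 : (m : ℝ)⁻¹ * ∑ i, disc θ' (D i) - (m : ℝ)⁻¹ * ∑ i, disc θ (D i) ≤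
        L * ‖θ - θ'‖ := by
      rw [← mul_sub, ← Finset.sum_sub_distrib, inv_mul_le_iff₀ (by exact_mod_cast hm)]
      refine (Finset.sum_le_sum (g := fun _ => L * ‖θ - θ'‖) fun i _ => ?_).trans (by simp)
      linarith [(abs_le.1 (hLip θ hθ θ' hθ' (D i))).1]
    simp only [hZ]
    linarith
  · intro ω b hb
    have := isProbabilityMeasure_empirical hk fun j => D (ω j)
    have : Nonempty F := by
      obtain ⟨θ, hθ⟩ := hne
      exact ⟨disc θ, hmem θ hθ⟩
    refine ciSup_le fun f => ?_
    obtain ⟨f, hf⟩ := f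
    obtain ⟨θ, hθ, rfl⟩ := hF ▸ hf
    dsimp only
    rw [integral_empirical _ (hmeas _ hf), integral_empirical _ (hmeas _ hf)]
    exact hb θ hθ

/-- With high probability, `k` samples from `empirical D` are close to it. The tail comes from
McDiarmid's inequality, as changing one sample changes the distance by at most `2 Δ / k`. -/
lemma measure_ipm_empirical_gt_le {X : Type*} [MeasurableSpace X] {p : ℕ} (hp : 0 < p)
    {Θ : Set (EuclideanSpace ℝ (Fin p))} {disc : EuclideanSpace ℝ (Fin p) → X → ℝ}
    {F : Set (X → ℝ)} (hF : F = disc '' Θ) (hne : Θ.Nonempty) (hmeas : ∀ f ∈ F, Measurable f)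
    {Δ L : ℝ} (heven : ∀ f ∈ F, -f ∈ F) (hbdd : ∀ f ∈ F, ∀ x, |f x| ≤ Δ) (hΔ : 0 < Δ)
    (hL : 0 < L) (hΘ : ∀ θ ∈ Θ, ∀ i, θ i ∈ Set.Icc (-1 : ℝ) 1)
    (hLip : ∀ θ ∈ Θ, ∀ θ' ∈ Θ, ∀ x, |disc θ x - disc θ' x| ≤ L * ‖θ - θ'‖)
    {m k : ℕ} (hm : 0 < m) (hk : 0 < k) (D : Fin m → X) {ξ : ℝ} (hξ : 0 < ξ) :
    (Measure.pi fun _ : Fin k => uniformOn (Set.univ : Set (Fin m)))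
      {idx | genConst p L Δ ξ / √k <
        2 * ipm F (empirical fun j => D (idx j)) (empirical D)} ≤ ENNReal.ofReal ξ := by
  have := isProbabilityMeasure_uniformOn_fin hm
  have := isProbabilityMeasure_empirical hm D
  have hk' : (0 : ℝ) < k := by exact_mod_cast hk
  rcases le_or_gt 1 ξ with h1 | h1
  · exact prob_le_one.trans (by simpa using h1)
  set g : (Fin k → Fin m) → ℝ := fun idx => ipm F (empirical fun j => D (idx j)) (empirical D)
    with hg
  have hdiff : ∀ ω i x, g (Function.update ω i x) - g ω ≤ 2 * Δ / k ∧
      g ω - g (Function.update ω i x) ≤ 2 * Δ / k := by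
    intro ω i x
    have := isProbabilityMeasure_empirical hk fun j => D (ω j)
    have := isProbabilityMeasure_empirical hk fun j => D (Function.update ω i x j)
    have hN : Neighboring (fun j => D (Function.update ω i x j)) (fun j => D (ω j)) :=
      ⟨i, fun j hj => by simp [Function.update_of_ne hj]⟩
    have hN' : Neighboring (fun j => D (ω j)) (fun j => D (Function.update ω i x j)) :=
      ⟨i, fun j hj => by simp [Function.update_of_ne hj]⟩
    have h1 := ipm_triangle heven hbdd (empirical fun j => D (Function.update ω i x j))
      (empirical fun j => D (ω j)) (empirical D)
    have h2 := ipm_triangle heven hbdd (empirical fun j => D (ω j))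
      (empirical fun j => D (Function.update ω i x j)) (empirical D)
    have h3 := ipm_empirical_le_of_neighboring hΔ.le hmeas hbdd hN
    have h4 := ipm_empirical_le_of_neighboring hΔ.le hmeas hbdd hN'
    simp only [hg]
    constructor <;> linarith
  have hlog : 0 < Real.log (1 / ξ) := Real.log_pos ((one_lt_div hξ).2 h1)
  have hmean := integral_ipm_empirical_le hp hF hne hmeas hL hΘ hLip hm hk D
  set s : ℝ := Δ * √(2 * Real.log (1 / ξ)) / √k with hs
  have htail := measure_le_sub_integral_le (uniformOn (Set.univ : Set (Fin m)))
    (c := 2 * Δ / k) (by positivity) hk g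
    (fun ω i x => abs_sub_le_iff.2 (hdiff ω i x)) (s := s) (by positivity)
  have hexp : Real.exp (-(2 * s ^ 2 / (k * (2 * Δ / k) ^ 2))) = ξ := by
    have h1 : √(k : ℝ) ^ 2 = k := Real.sq_sqrt hk'.le
    have h2 : √(2 * Real.log (1 / ξ)) ^ 2 = 2 * Real.log (1 / ξ) := Real.sq_sqrt (by positivity)
    have h3 : 2 * s ^ 2 / (k * (2 * Δ / k) ^ 2) = Real.log (1 / ξ) := by
      rw [hs, div_pow, mul_pow, h1, h2]
      field_simp
    rw [h3, one_div, Real.log_inv, neg_neg, Real.exp_log hξ]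
  rw [hexp] at htail
  refine (measure_mono fun ω hω => ?_).trans htail
  simp only [Set.mem_ofPred_eq] at hω ⊢
  -- the chaining constant `4 * 4 √(2 log 2)` is below `8 √(2 π)`
  have hconst : 16 * √(2 * Real.log 2) ≤ 8 * √(2 * Real.pi) := by
    have h1 : 16 * √(2 * Real.log 2) = √(16 ^ 2 * (2 * Real.log 2)) := by
      rw [Real.sqrt_mul (by positivity) (2 * Real.log 2), Real.sqrt_sq (by positivity)]
    have h2 : 8 * √(2 * Real.pi) = √(8 ^ 2 * (2 * Real.pi)) := by
      rw [Real.sqrt_mul (by positivity) (2 * Real.pi), Real.sqrt_sq (by positivity)]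
    rw [h1, h2]
    refine Real.sqrt_le_sqrt ?_
    linarith [Real.log_two_lt_d9, Real.pi_gt_three]
  have hle : 16 * √(2 * Real.log 2) * p * (L / √k) ≤ 8 * √(2 * Real.pi) * p * (L / √k) := by
    gcongr
  have hgen : genConst p L Δ ξ / √k = 2 * (8 * √(2 * Real.pi) * p * (L / √k)) + 2 * s := by
    rw [genConst, hs]
    ring
  rw [hgen] at hω
  linarith

/-! ### Privacy from the symmetrized Kullback-Leibler divergence -/

lemma eq_withDensity_exp {X : Type*} [MeasurableSpace X] {ref P Q : Measure X} [SigmaFinite ref]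
    [IsProbabilityMeasure P] [IsProbabilityMeasure Q] (hP : P ≪ ref ∧ ref ≪ P)
    (hQ : Q ≪ ref ∧ ref ≪ Q) {h : X → ℝ} (hmeas : Measurable h)
    (hh : logDensityRatio ref P Q =ᵐ[ref] h) :
    P = Q.withDensity fun x => ENNReal.ofReal (Real.exp (h x)) := by
  have hexp : Measurable fun x => ENNReal.ofReal (Real.exp (h x)) := by fun_prop
  nth_rewrite 1 [← Measure.withDensity_rnDeriv_eq Q ref hQ.1]
  rw [← withDensity_mul _ (Measure.measurable_rnDeriv Q ref) hexp]
  nth_rewrite 1 [← Measure.withDensity_rnDeriv_eq P ref hP.1]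
  refine withDensity_congr_ae ?_
  filter_upwards [hh, Measure.rnDeriv_pos' hP.2, Measure.rnDeriv_pos' hQ.2,
    Measure.rnDeriv_lt_top P ref, Measure.rnDeriv_lt_top Q ref] with x hx hp hq hp' hq'
  have hp0 := ENNReal.toReal_pos hp.ne' hp'.ne
  have hq0 := ENNReal.toReal_pos hq.ne' hq'.ne
  rw [Pi.mul_apply, ← hx, logDensityRatio, density, density, Real.exp_log (by positivity)]
  refine (ENNReal.toReal_eq_toReal_iff' hp'.ne
    (ENNReal.mul_ne_top hq'.ne ENNReal.ofReal_ne_top)).1 ?_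
  rw [ENNReal.toReal_mul, ENNReal.toReal_ofReal (by positivity)]
  field_simp

lemma pi_withDensity {X : Type*} [MeasurableSpace X] {ι : Type*} [Fintype ι] (Q : Measure X)
    [IsProbabilityMeasure Q] {f : X → ℝ≥0∞} (hf : Measurable f) [SigmaFinite (Q.withDensity f)] :
    (Measure.pi fun _ : ι => Q.withDensity f) =
      (Measure.pi fun _ : ι => Q).withDensity fun x => ∏ i, f (x i) := by
  refine Measure.pi_eq fun s hs => ?_
  have hg : ∀ i, Measurable ((s i).indicator f) := fun i => hf.indicator (hs i)
  have hind : iIndepFun (fun i (x : ι → X) => (s i).indicator f (x i)) (Measure.pi fun _ => Q) :=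
    iIndepFun_pi fun i => (hg i).aemeasurable
  rw [withDensity_apply _ (MeasurableSet.univ_pi hs),
    ← lintegral_indicator (MeasurableSet.univ_pi hs)]
  have hprod : ∀ x : ι → X, (Set.univ.pi s).indicator (fun x => ∏ i, f (x i)) x =
      ∏ i, (s i).indicator f (x i) := by
    intro x
    by_cases hx : x ∈ Set.univ.pi s
    · rw [Set.indicator_of_mem hx]
      exact Finset.prod_congr rfl fun i _ => (Set.indicator_of_mem (hx i trivial) f).symm
    · rw [Set.indicator_of_notMem hx]
      simp only [Set.mem_pi, Set.mem_univ, true_imp_iff, not_forall] at hx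
      obtain ⟨i, hi⟩ := hx
      exact (Finset.prod_eq_zero (Finset.mem_univ i) (Set.indicator_of_notMem hi f)).symm
  simp_rw [hprod]
  rw [lintegral_prod_eq_prod_lintegral_of_indepFun _ _ hind
    fun i => (hg i).comp (measurable_pi_apply i)]
  refine Finset.prod_congr rfl fun i _ => ?_
  rw [(measurePreserving_eval (fun _ : ι => Q) i).lintegral_comp (hg i),
    lintegral_indicator (hs i), withDensity_apply _ (hs i)]

/-- A bound on the symmetrized Kullback-Leibler divergence `∫ T dP - ∫ T dQ`, where
`T = log (dP / dQ)`, gives privacy: its integrand `T (exp T - 1)` with respect to `Q` is nonnegative,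
and at least `ε (1 - exp (-ε)) exp T` where `T` exceeds `ε`. -/
lemma measure_le_of_eq_withDensity_exp {Y : Type*} [MeasurableSpace Y] {P Q : Measure Y}
    [IsProbabilityMeasure P] [IsProbabilityMeasure Q] {T : Y → ℝ} (hT : Measurable T) {B : ℝ}
    (hB : ∀ y, |T y| ≤ B) (hPQ : P = Q.withDensity fun y => ENNReal.ofReal (Real.exp (T y)))
    {ε : ℝ} (hε : 0 < ε) {S : Set Y} (hS : MeasurableSet S) :
    P S ≤ ENNReal.ofReal (Real.exp ε) * Q S +
      ENNReal.ofReal ((∫ y, T y ∂P - ∫ y, T y ∂Q) / (ε * (1 - Real.exp (-ε)))) := by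
  set A : Set Y := {y | ε < T y} with hA
  have hAm : MeasurableSet A := measurableSet_lt measurable_const hT
  have hexp : Measurable fun y => ENNReal.ofReal (Real.exp (T y)) := by fun_prop
  have hc : 0 < 1 - Real.exp (-ε) := by simpa using hε
  have hgood : P (S \ A) ≤ ENNReal.ofReal (Real.exp ε) * Q S := by
    rw [hPQ, withDensity_apply _ (hS.diff hAm)]
    calc ∫⁻ y in S \ A, ENNReal.ofReal (Real.exp (T y)) ∂Q
        ≤ ∫⁻ _ in S \ A, ENNReal.ofReal (Real.exp ε) ∂Q := by
          refine setLIntegral_mono measurable_const fun y hy => ?_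
          exact ENNReal.ofReal_le_ofReal (Real.exp_le_exp.2 (not_lt.1 hy.2))
      _ ≤ _ := by
          rw [setLIntegral_const]
          gcongr
          exact Set.sdiff_subset
  have hint : ∀ g : Y → ℝ, ∫ y, g y ∂P = ∫ y, Real.exp (T y) * g y ∂Q := by
    intro g
    rw [hPQ, integral_withDensity_eq_integral_toReal_smul hexp (ae_of_all _ fun _ => by simp)]
    simp [ENNReal.toReal_ofReal (Real.exp_pos _).le]
  have hTlow : ∀ y, -B ≤ T y := fun y => (abs_le.1 (hB y)).1
  have hTup : ∀ y, T y ≤ B := fun y => (abs_le.1 (hB y)).2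
  have hexpbound : ∀ y, ‖Real.exp (T y)‖ ≤ Real.exp B := fun y => by
    rw [Real.norm_of_nonneg (Real.exp_pos _).le]
    exact Real.exp_le_exp.2 (hTup y)
  have hTint : Integrable T Q :=
    .of_bound hT.aestronglyMeasurable B (ae_of_all Q fun y => (Real.norm_eq_abs _).trans_le (hB y))
  have heTint : Integrable (fun y => Real.exp (T y) * T y) Q :=
    hTint.bdd_mul (by fun_prop) (ae_of_all _ hexpbound)
  have heAint : Integrable (fun y => Real.exp (T y) * A.indicator 1 y) Q :=
    ((integrable_const (1 : ℝ)).indicator hAm).bdd_mul (by fun_prop) (ae_of_all _ hexpbound)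
  have hbad : (ε * (1 - Real.exp (-ε))) * P.real A ≤ ∫ y, T y ∂P - ∫ y, T y ∂Q := by
    rw [← integral_indicator_one hAm, hint T, hint (A.indicator 1), ← integral_sub heTint hTint,
      ← integral_const_mul]
    refine integral_mono (heAint.const_mul _) (heTint.sub hTint) fun y => ?_
    dsimp only
    by_cases hy : y ∈ A
    · have hy' : ε < T y := hy
      have h1 : Real.exp (T y) * Real.exp (-ε) ≥ 1 := by
        rw [← Real.exp_add]
        exact Real.one_le_exp (by linarith)
      have h2 : 0 ≤ Real.exp (T y) - 1 := by
        linarith [Real.one_le_exp (hε.le.trans hy'.le)]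
      rw [Set.indicator_of_mem hy, Pi.one_apply]
      nlinarith
    · rw [Set.indicator_of_notMem hy]
      have : 0 ≤ T y * (Real.exp (T y) - 1) := by
        rcases le_total 0 (T y) with h | h
        · exact mul_nonneg h (by linarith [Real.one_le_exp h])
        · exact mul_nonneg_of_nonpos_of_nonpos h (by linarith [Real.exp_le_one_iff.2 h])
      linarith
  calc P S ≤ P (S \ A) + P A := by
        refine (measure_mono fun y hy => ?_).trans (measure_union_le _ _)
        by_cases hyA : y ∈ A
        · exact Or.inr hyA
        · exact Or.inl ⟨hy, hyA⟩
    _ ≤ _ := by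
        gcongr
        rw [← ofReal_measureReal (μ := P) (s := A)]
        refine ENNReal.ofReal_le_ofReal ?_
        rw [le_div_iff₀ (by positivity)]
        linarith

lemma pi_le_of_represents {X : Type*} [MeasurableSpace X] {ref P Q : Measure X} [SigmaFinite ref]
    [IsProbabilityMeasure P] [IsProbabilityMeasure Q] (hP : P ≪ ref ∧ ref ≪ P)
    (hQ : Q ≪ ref ∧ ref ≪ Q) {F : Set (X → ℝ)} (hmeas : ∀ f ∈ F, Measurable f) {Δ : ℝ}
    (heven : ∀ f ∈ F, -f ∈ F) (hbdd : ∀ f ∈ F, ∀ x, |f x| ≤ Δ) {N : ℕ} {w₀ : ℝ} {w : Fin N → ℝ}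
    {f : Fin N → X → ℝ} (hrep : Represents F ref (logDensityRatio ref P Q) w₀ w f) {ε : ℝ}
    (hε : 0 < ε) {n : ℕ} {S : Set (Fin n → X)} (hS : MeasurableSet S) :
    (Measure.pi fun _ => P) S ≤ ENNReal.ofReal (Real.exp ε) * (Measure.pi fun _ => Q) S +
      ENNReal.ofReal (n * ((∑ i, |w i|) * ipm F P Q) / (ε * (1 - Real.exp (-ε)))) := by
  obtain ⟨hfF, hae⟩ := hrep
  set h : X → ℝ := fun x => w₀ + ∑ i, w i * f i x with hh
  have hfm : ∀ i, Measurable (f i) := fun i => hmeas _ (hfF i)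
  have hhm : Measurable h := by fun_prop
  have hc : 0 < 1 - Real.exp (-ε) := by simpa using hε
  have hPQ := eq_withDensity_exp hP hQ hhm hae
  have hbound : ∀ x, |h x| ≤ |w₀| + ∑ i, |w i| * Δ := by
    intro x
    refine (abs_add_le _ _).trans ?_
    gcongr
    refine (Finset.abs_sum_le_sum_abs _ _).trans (Finset.sum_le_sum fun i _ => ?_)
    rw [abs_mul]
    gcongr
    exact hbdd _ (hfF i) x
  have hsf : SigmaFinite (Q.withDensity fun x => ENNReal.ofReal (Real.exp (h x))) := by
    rw [← hPQ]
    infer_instance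
  have hpi : (Measure.pi fun _ : Fin n => P) = (Measure.pi fun _ : Fin n => Q).withDensity
      fun x => ENNReal.ofReal (Real.exp (∑ i, h (x i))) := by
    conv_lhs => rw [hPQ]
    rw [pi_withDensity Q (by fun_prop)]
    congr 1 with x
    rw [Real.exp_sum, ENNReal.ofReal_prod_of_nonneg fun i _ => (Real.exp_pos _).le]
  have hTint : ∀ (μ : Measure X) [IsProbabilityMeasure μ],
      ∫ x, ∑ i, h (x i) ∂(Measure.pi fun _ : Fin n => μ) = n * ∫ x, h x ∂μ := by
    intro μ _
    have hint : Integrable h μ := .of_bound hhm.aestronglyMeasurable _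
      (ae_of_all μ fun x => (Real.norm_eq_abs _).trans_le (hbound x))
    rw [integral_finsetSum _ fun i _ => integrable_comp_eval (μ := fun _ : Fin n => μ) hint]
    simp_rw [integral_comp_eval (μ := fun _ : Fin n => μ) hhm.aestronglyMeasurable]
    simp
  have hhint : ∀ (μ : Measure X) [IsProbabilityMeasure μ],
      ∫ x, h x ∂μ = w₀ + ∑ i, w i * ∫ x, f i x ∂μ := by
    intro μ _
    have hint : ∀ i, Integrable (fun x => w i * f i x) μ := fun i =>
      (Integrable.of_bound (hfm i).aestronglyMeasurable Δ
        (ae_of_all μ fun x => (Real.norm_eq_abs _).trans_le (hbdd _ (hfF i) x))).const_mul _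
    rw [hh, integral_add (integrable_const _) (integrable_finsetSum _ fun i _ => hint i),
      integral_finsetSum _ fun i _ => hint i]
    simp [integral_const_mul]
  have hT : ∀ x : Fin n → X, |∑ i, h (x i)| ≤ ∑ _i : Fin n, (|w₀| + ∑ i, |w i| * Δ) := fun x =>
    (Finset.abs_sum_le_sum_abs _ _).trans (Finset.sum_le_sum fun i _ => hbound (x i))
  refine (measure_le_of_eq_withDensity_exp (by fun_prop) hT hpi hε hS).trans ?_
  gcongr
  rw [hTint, hTint, ← mul_sub]
  gcongr
  rw [hhint, hhint, add_sub_add_left_eq_sub, ← Finset.sum_sub_distrib, Finset.sum_mul]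
  refine Finset.sum_le_sum fun i _ => ?_
  rw [← mul_sub]
  refine (le_abs_self _).trans ?_
  rw [abs_mul]
  gcongr
  exact abs_integral_sub_integral_le_ipm heven hbdd P Q (hfF i)

/-- Two generators whose log-density ratio lies in the span of `F` produce samples that are as hard
to tell apart as their `ipm F` distance says. When this distance vanishes and the variation norm is
infinite, their product is `0`, which is right because some representation has finite weights. -/
lemma pi_le_add_variationNorm {X : Type*} [MeasurableSpace X] {ref P Q : Measure X}
    [SigmaFinite ref] [IsProbabilityMeasure P] [IsProbabilityMeasure Q] (hP : P ≪ ref ∧ ref ≪ P)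
    (hQ : Q ≪ ref ∧ ref ≪ Q) {F : Set (X → ℝ)} (hmeas : ∀ f ∈ F, Measurable f) {Δ : ℝ}
    (heven : ∀ f ∈ F, -f ∈ F) (hbdd : ∀ f ∈ F, ∀ x, |f x| ≤ Δ)
    (hspan : InSpan F ref (logDensityRatio ref P Q)) {ε : ℝ}
    (hε : 0 < ε) {n : ℕ} {S : Set (Fin n → X)} (hS : MeasurableSet S) :
    (Measure.pi fun _ => P) S ≤ ENNReal.ofReal (Real.exp ε) * (Measure.pi fun _ => Q) S +
      n * variationNorm F ref (logDensityRatio ref P Q) /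
        ENNReal.ofReal (ε * (1 - Real.exp (-ε))) * ENNReal.ofReal (ipm F P Q) := by
  have hc : 0 < 1 - Real.exp (-ε) := by simpa using hε
  have he : 0 < ε * (1 - Real.exp (-ε)) := by positivity
  set K : ℝ≥0∞ := n / ENNReal.ofReal (ε * (1 - Real.exp (-ε))) * ENNReal.ofReal (ipm F P Q) with hK
  have hKtop : K ≠ ∞ := ENNReal.mul_ne_top (ENNReal.div_ne_top (ENNReal.natCast_ne_top n)
    (ENNReal.ofReal_pos.2 he).ne') ENNReal.ofReal_ne_top
  have hcomm : ∀ v : ℝ≥0∞, n * v / ENNReal.ofReal (ε * (1 - Real.exp (-ε))) *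
      ENNReal.ofReal (ipm F P Q) = K * v := by
    intro v
    rw [hK, ENNReal.div_eq_inv_mul, ENNReal.div_eq_inv_mul]
    ring
  rw [hcomm]
  have hrepr : ∀ (N : ℕ) (w₀ : ℝ) (w : Fin N → ℝ) (f : Fin N → X → ℝ),
      Represents F ref (logDensityRatio ref P Q) w₀ w f →
      (Measure.pi fun _ => P) S ≤ ENNReal.ofReal (Real.exp ε) * (Measure.pi fun _ => Q) S +
        K * ∑ i, ENNReal.ofReal |w i| := by
    intro N w₀ w f hrep
    refine (pi_le_of_represents hP hQ hmeas heven hbdd hrep hε hS).trans (le_of_eq ?_)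
    rw [← hcomm, ENNReal.ofReal_div_of_pos he, ENNReal.ofReal_mul (by positivity),
      ENNReal.ofReal_mul (Finset.sum_nonneg fun i _ => abs_nonneg _), ENNReal.ofReal_natCast,
      ENNReal.ofReal_sum_of_nonneg fun i _ => abs_nonneg _, ENNReal.div_eq_inv_mul,
      ENNReal.div_eq_inv_mul]
    ring
  rcases eq_or_ne K 0 with hK0 | hK0
  · obtain ⟨N, w₀, w, f, hrep⟩ := hspan
    simpa [hK0] using hrepr N w₀ w f hrep
  rw [← tsub_le_iff_left, ← ENNReal.div_le_iff' hK0 hKtop]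
  refine le_iInf fun N => le_iInf fun w₀ => le_iInf fun w => le_iInf fun f => le_iInf fun hrep => ?_
  rw [ENNReal.div_le_iff' hK0 hKtop, tsub_le_iff_left]
  exact hrepr N w₀ w f hrep

/-! ### The mechanism -/

lemma ganMechanism_apply {X A : Type*} [MeasurableSpace X] [MeasurableSpace A] (gen : Kernel A X)
    [IsMarkovKernel gen] {m k n : ℕ} (train : (Fin k → X) → ProbabilityMeasure A) (D : Fin m → X)
    {S : Set (Fin n → X)} (hS : MeasurableSet S) :
    ganMechanism gen train m n D S =
      ∫⁻ idx, ∫⁻ a, (Measure.pi fun _ => gen a) S ∂(train fun j => D (idx j) : Measure A)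
        ∂(Measure.pi fun _ : Fin k => uniformOn (Set.univ : Set (Fin m))) := by
  rw [ganMechanism, Measure.bind_apply hS Measurable.of_discrete.aemeasurable]
  refine lintegral_congr fun idx => ?_
  rw [Measure.bind_apply hS (iidSamples gen n).measurable.aemeasurable]
  rfl

/-- It suffices to compare the generators obtained from typical resamplings of the two datasets,
as the resamplings and the training can be taken independent. -/
lemma ganMechanism_le {X A : Type*} [MeasurableSpace X] [MeasurableSpace A] (gen : Kernel A X)
    [IsMarkovKernel gen] {m k n : ℕ} (hm : 0 < m) (train : (Fin k → X) → ProbabilityMeasure A)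
    (D₀ D₁ : Fin m → X) {S : Set (Fin n → X)} (hS : MeasurableSet S) {κ c : ℝ≥0∞}
    (bad₀ bad₁ : Set (Fin k → Fin m))
    (h : ∀ ω₀ ∉ bad₀, ∀ ω₁ ∉ bad₁, ∀ᵐ a ∂(train fun j => D₀ (ω₀ j) : Measure A),
      ∀ᵐ b ∂(train fun j => D₁ (ω₁ j) : Measure A),
      (Measure.pi fun _ => gen a) S ≤ κ * (Measure.pi fun _ => gen b) S + c) :
    ganMechanism gen train m n D₀ S ≤ κ * ganMechanism gen train m n D₁ S + c +
      (Measure.pi fun _ : Fin k => uniformOn (Set.univ : Set (Fin m))) bad₀ +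
      (Measure.pi fun _ : Fin k => uniformOn (Set.univ : Set (Fin m))) bad₁ := by
  have := isProbabilityMeasure_uniformOn_fin hm
  rw [ganMechanism_apply gen train D₀ hS, ganMechanism_apply gen train D₁ hS]
  set P := Measure.pi fun _ : Fin k => uniformOn (Set.univ : Set (Fin m)) with hP
  set φ : A → ℝ≥0∞ := fun a => (Measure.pi fun _ => gen a) S with hφ
  have hφm : Measurable φ := (iidSamples gen n).measurable_coe hS
  set U : (Fin k → Fin m) → ℝ≥0∞ := fun ω => ∫⁻ a, φ a ∂(train fun j => D₀ (ω j) : Measure A)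
  set V : (Fin k → Fin m) → ℝ≥0∞ := fun ω => ∫⁻ a, φ a ∂(train fun j => D₁ (ω j) : Measure A)
  have hU1 : ∀ ω, U ω ≤ 1 := fun ω =>
    (lintegral_mono fun a => (prob_le_one : φ a ≤ 1)).trans (by simp)
  have hUV : ∀ ω₀ ω₁, U ω₀ ≤ κ * V ω₁ + c + bad₀.indicator 1 ω₀ + bad₁.indicator 1 ω₁ := by
    intro ω₀ ω₁
    by_cases h₀ : ω₀ ∈ bad₀
    · rw [Set.indicator_of_mem h₀]
      exact (hU1 ω₀).trans (le_add_right (le_add_left le_rfl))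
    by_cases h₁ : ω₁ ∈ bad₁
    · rw [Set.indicator_of_mem h₁]
      exact (hU1 ω₀).trans (le_add_left le_rfl)
    refine le_add_right (le_add_right ?_)
    have hab : ∀ᵐ a ∂(train fun j => D₀ (ω₀ j) : Measure A), φ a ≤ κ * V ω₁ + c := by
      filter_upwards [h ω₀ h₀ ω₁ h₁] with a ha
      have := lintegral_mono_ae ha
      rw [lintegral_const, measure_univ, mul_one, lintegral_add_right _ measurable_const,
        lintegral_const_mul _ hφm, lintegral_const, measure_univ, mul_one] at this
      exact this
    refine (lintegral_mono_ae hab).trans (le_of_eq ?_)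
    rw [lintegral_const, measure_univ, mul_one]
  have hmeas : ∀ g : (Fin k → Fin m) → ℝ≥0∞, Measurable g := fun _ => .of_discrete
  have h₁ : ∀ ω₀, U ω₀ ≤ κ * ∫⁻ ω, V ω ∂P + c + bad₀.indicator 1 ω₀ + P bad₁ := by
    intro ω₀
    have := lintegral_mono (μ := P) (hUV ω₀)
    rw [lintegral_const, measure_univ, mul_one, lintegral_add_left (hmeas _),
      lintegral_add_right _ measurable_const, lintegral_add_right _ measurable_const,
      lintegral_const_mul _ (hmeas V), lintegral_const, lintegral_const, measure_univ, mul_one,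
      mul_one, lintegral_indicator_one .of_discrete] at this
    exact this
  have := lintegral_mono (μ := P) h₁
  rw [lintegral_add_right _ measurable_const, lintegral_add_left measurable_const,
    lintegral_const, lintegral_const, measure_univ, mul_one, mul_one,
    lintegral_indicator_one .of_discrete] at this
  exact this

section errBound

variable {X A : Type*} [MeasurableSpace X] {F : Set (X → ℝ)} {Δ : ℝ}

lemma bddBelow_range_ipm [Nonempty A] (heven : ∀ f ∈ F, -f ∈ F) (hbdd : ∀ f ∈ F, ∀ x, |f x| ≤ Δ)
    (gen : A → Measure X) [∀ a, IsProbabilityMeasure (gen a)] (μ : Measure X)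
    [IsProbabilityMeasure μ] : BddBelow (Set.range fun a => ipm F μ (gen a)) :=
  ⟨0, by rintro _ ⟨a, rfl⟩; exact ipm_nonneg heven hbdd μ (gen a)⟩

lemma errBound_le_datasetErrBound [Nonempty A] (heven : ∀ f ∈ F, -f ∈ F)
    (hbdd : ∀ f ∈ F, ∀ x, |f x| ≤ Δ) (hΔ : 0 ≤ Δ) (gen : A → Measure X)
    [∀ a, IsProbabilityMeasure (gen a)] (p : ℕ) (L τ : ℝ) {m : ℕ} (hm : 0 < m) (k : ℕ) (ξ : ℝ)
    (D : Fin m → X) :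
    errBound F gen p L Δ τ k ξ (empirical D) ≤ datasetErrBound F gen p L Δ τ m k ξ := by
  refine le_ciSup (f := fun D : Fin m → X => errBound F gen p L Δ τ k ξ (empirical D))
    ⟨2 * (2 * Δ + τ + genConst p L Δ ξ / √k), ?_⟩ D
  rintro _ ⟨D, rfl⟩
  have := isProbabilityMeasure_empirical hm D
  obtain ⟨a⟩ := ‹Nonempty A›
  have h1 : ⨅ a, ipm F (empirical D) (gen a) ≤ ipm F (empirical D) (gen a) :=
    ciInf_le (bddBelow_range_ipm (A := A) heven hbdd gen (empirical D)) a
  have h2 : ipm F (empirical D) (gen a) ≤ 2 * Δ := ipm_le (by positivity) fun f hf => by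
    linarith [(abs_le.1 (abs_integral_le_of_mem hbdd (empirical D) hf)).2,
      (abs_le.1 (abs_integral_le_of_mem hbdd (gen a) hf)).1]
  simp only [errBound]
  linarith

/-- A generator that is near-optimal for a sample is near-optimal for the distribution that the
sample comes from, up to twice the distance between the two. -/
lemma ipm_gen_le_of_opt [Nonempty A] (heven : ∀ f ∈ F, -f ∈ F) (hbdd : ∀ f ∈ F, ∀ x, |f x| ≤ Δ)
    (gen : A → Measure X) [∀ a, IsProbabilityMeasure (gen a)] (μ ρ : Measure X)
    [IsProbabilityMeasure μ] [IsProbabilityMeasure ρ] {τ : ℝ} {a : A}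
    (ha : ipm F ρ (gen a) - ⨅ b, ipm F ρ (gen b) ≤ τ) :
    ipm F μ (gen a) ≤ (⨅ b, ipm F μ (gen b)) + τ + 2 * ipm F ρ μ := by
  have h1 : (⨅ b, ipm F ρ (gen b)) - ipm F ρ μ ≤ ⨅ b, ipm F μ (gen b) := by
    refine le_ciInf fun b => ?_
    have h2 := ciInf_le (bddBelow_range_ipm (A := A) heven hbdd gen ρ) b
    have h3 := ipm_triangle heven hbdd ρ μ (gen b)
    linarith
  have h4 := ipm_triangle heven hbdd μ ρ (gen a)
  have h5 := ipm_comm_le heven hbdd μ ρ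
  linarith

end errBound

end GANPrivacy

open GANPrivacy in
theorem theorem1
    {X A : Type*} [MeasurableSpace X] [MeasurableSpace A]
    -- the generators `gen a`: probability distributions with positive densities w.r.t. `ref`
    (ref : Measure X) [SigmaFinite ref] (gen : Kernel A X) [IsMarkovKernel gen]
    (hgen : ∀ a, gen a ≪ ref ∧ ref ≪ gen a)
    -- the discriminators `disc θ`, `θ ∈ Θ`, which form the set `F`
    (p : ℕ) (Θ : Set (EuclideanSpace ℝ (Fin p))) (disc : EuclideanSpace ℝ (Fin p) → X → ℝ)
    (F : Set (X → ℝ)) (hF : F = disc '' Θ) (hmeas : ∀ f ∈ F, Measurable f)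
    -- log-density ratios lie in the span of the discriminators
    (hspan : ∀ a b, InSpan F ref (logDensityRatio ref (gen a) (gen b)))
    -- the discriminator set is even and bounded by `Δ`
    (Δ : ℝ) (heven : ∀ f ∈ F, -f ∈ F) (hbdd : ∀ f ∈ F, ∀ x, |f x| ≤ Δ)
    -- the discriminators have parameters in a cube and are Lipschitz in them
    (L : ℝ) (hΘ : ∀ θ ∈ Θ, ∀ i, θ i ∈ Set.Icc (-1 : ℝ) 1)
    (hLip : ∀ θ ∈ Θ, ∀ θ' ∈ Θ, ∀ x, |disc θ x - disc θ' x| ≤ L * ‖θ - θ'‖)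
    -- training on `k` samples, with optimization error at most `τ`
    (m k n : ℕ) (hm : 0 < m) (hk : 0 < k)
    (train : (Fin k → X) → ProbabilityMeasure A) (τ : ℝ)
    (hopt : ∀ T : Fin k → X, ∀ᵐ a ∂(train T : Measure A),
      ipm F (empirical T) (gen a) - ⨅ b, ipm F (empirical T) (gen b) ≤ τ)
    (ε ξ δ : ℝ) (hε : 0 < ε) (hξ : 0 < ξ)
    (hδ : n * complexity F ref gen / ENNReal.ofReal (ε * (1 - Real.exp (-ε))) *
        ENNReal.ofReal (2 * Δ / m + datasetErrBound F gen p L Δ τ m k ξ) +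
        2 * ENNReal.ofReal ξ < ENNReal.ofReal δ) :
    IsDifferentiallyPrivate (ganMechanism gen train m n) ε δ := by
  intro D₀ D₁ hD S hS
  have hpair : ∀ a b, (Measure.pi fun _ : Fin n => gen a) S ≤
      ENNReal.ofReal (Real.exp ε) * (Measure.pi fun _ : Fin n => gen b) S +
        n * complexity F ref gen / ENNReal.ofReal (ε * (1 - Real.exp (-ε))) *
          ENNReal.ofReal (ipm F (gen a) (gen b)) := by
    intro a b
    refine (pi_le_add_variationNorm (hgen a) (hgen b) hmeas heven hbdd (hspan a b) hε hS).trans ?_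
    gcongr
    exact le_iSup₂ (f := fun a b => variationNorm F ref (logDensityRatio ref (gen a) (gen b))) a b
  by_cases hzero : ∀ f ∈ F, ∀ x, f x = 0
  · -- There is nothing to discriminate: all generators coincide in law.
    have hipm : ∀ a b, ipm F (gen a) (gen b) ≤ 0 := fun a b =>
      ipm_le le_rfl fun f hf => by simp [hzero f hf]
    have h := ganMechanism_le gen hm train D₀ D₁ hS (κ := ENNReal.ofReal (Real.exp ε)) (c := 0) ∅ ∅
      fun ω₀ _ ω₁ _ => ae_of_all _ fun a => ae_of_all _ fun b => by
        simpa [ENNReal.ofReal_of_nonpos (hipm a b)] using hpair a b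
    simp only [measure_empty, add_zero] at h
    exact h.trans le_self_add
  push Not at hzero
  obtain ⟨f, hf, x, hx⟩ := hzero
  have hΔ : 0 < Δ := (abs_pos.2 hx).trans_le (hbdd f hf x)
  obtain ⟨θ, hθ, hθf⟩ := hF ▸ hf
  obtain ⟨θ', hθ', hθf'⟩ := hF ▸ heven f hf
  -- `f` and `-f` differ at `x`, so that their parameters differ
  have hne : θ ≠ θ' := by
    rintro rfl
    have := congrFun (hθf.symm.trans hθf') x
    rw [Pi.neg_apply] at this
    exact hx (by linarith)
  have hL : 0 < L := by
    have h1 := hLip θ hθ θ' hθ' x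
    rw [hθf, hθf', Pi.neg_apply, sub_neg_eq_add] at h1
    have h2 : 0 < |f x + f x| := abs_pos.2 (by simpa [← two_mul] using hx)
    exact pos_of_mul_pos_left (h2.trans_le h1) (norm_nonneg _)
  have hp : 0 < p := by
    rcases Nat.eq_zero_or_pos p with rfl | hp
    · exact absurd (Subsingleton.elim θ θ') hne
    · exact hp
  have hA : Nonempty A := nonempty_of_isProbabilityMeasure (train fun _ => x : Measure A)
  set bad : (Fin m → X) → Set (Fin k → Fin m) := fun D => {idx | genConst p L Δ ξ / √k <
    2 * ipm F (empirical fun j => D (idx j)) (empirical D)} with hbad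
  have hbadm : ∀ D, (Measure.pi fun _ : Fin k => uniformOn (Set.univ : Set (Fin m))) (bad D) ≤
      ENNReal.ofReal ξ := fun D =>
    measure_ipm_empirical_gt_le hp hF ⟨θ, hθ⟩ hmeas heven hbdd hΔ hL hΘ hLip hm hk D hξ
  have hnear : ∀ D : Fin m → X, ∀ ω ∉ bad D, ∀ᵐ a ∂(train fun j => D (ω j) : Measure A),
      2 * ipm F (empirical D) (gen a) ≤ datasetErrBound F gen p L Δ τ m k ξ := by
    intro D ω hω
    have := isProbabilityMeasure_empirical hm D
    have := isProbabilityMeasure_empirical hk fun j => D (ω j)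
    filter_upwards [hopt fun j => D (ω j)] with a ha
    refine le_trans ?_ (errBound_le_datasetErrBound heven hbdd hΔ.le gen p L τ hm k ξ D)
    have h1 := ipm_gen_le_of_opt heven hbdd gen (empirical D) (empirical fun j => D (ω j)) ha
    simp only [hbad, Set.mem_ofPred_eq, not_lt] at hω
    rw [errBound]
    linarith
  have h := ganMechanism_le gen hm train D₀ D₁ hS (bad D₀) (bad D₁) fun ω₀ h₀ ω₁ h₁ => by
    filter_upwards [hnear D₀ ω₀ h₀] with a ha
    filter_upwards [hnear D₁ ω₁ h₁] with b hb
    have := isProbabilityMeasure_empirical hm D₀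
    have := isProbabilityMeasure_empirical hm D₁
    have h1 := ipm_triangle heven hbdd (gen a) (empirical D₀) (gen b)
    have h2 := ipm_triangle heven hbdd (empirical D₀) (empirical D₁) (gen b)
    have h3 := ipm_empirical_le_of_neighboring hΔ.le hmeas hbdd hD
    have h4 := ipm_comm_le heven hbdd (gen a) (empirical D₀)
    have h5 : ipm F (gen a) (gen b) ≤ 2 * Δ / m + datasetErrBound F gen p L Δ τ m k ξ := by
      linarith
    exact (hpair a b).trans (add_le_add_right
      (mul_le_mul_right (ENNReal.ofReal_le_ofReal h5) _) _)
  refine h.trans ?_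
  rw [add_assoc, add_assoc]
  refine add_le_add_right ?_ _
  refine le_trans ?_ hδ.le
  rw [two_mul (ENNReal.ofReal ξ)]
  exact add_le_add_right (add_le_add (hbadm D₀) (hbadm D₁)) _
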